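/- Let $(\bar M, g)$ be an $(n+r)$-dimensional smooth Riemannian manifold with Levi-Civita connection $\bar\nabla$, let $p, q$ be positive integers, and let $J$ be a smooth $(1,1)$-tensor field on $\bar M$ with $J^2 = pJ + qI$, $g(JX,Y) = g(X,JY)$ for all vector fields $X, Y$, and $\bar\nabla J = 0$; that is, $(\bar M, J, g)$ is a locally metallic Riemannian manifold. Let $M$ be an $n$-dimensional Riemannian manifold isometrically immersed in $\bar M$ (so $M$ carries the induced metric, also denoted $g$), and assume that $M$ is invariant: $J(T_xM) \subseteq T_xM$ for every $x \in M$. Let $T$ be the induced $(1,1)$-tensor field on $M$, $TX := (JX)^{T}$ (tangential component of $JX$). For a normal vector $\xi$ at $x\in M$ let $A_\xi : T_xM \to T_xM$ be the shape operator, $g(A_\xi X, Y) = g(h(X,Y), \xi)$, where $h(X,Y) = (\bar\nabla_X Y)^{\perp}$ is the second fundamental form. Then: 1. for every (local) smooth orthonormal frame $N_1, \dots, N_r$ of the normal bundle of $M$, $$T A_{N_\alpha} = A_{N_\alpha} T \qquad (1 \le \alpha \le r)$$ on the domain of the frame; 2. the Nijenhuis tensor field of $T$ vanishes identically on $M$: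 for all smooth vector fields $X, Y$ on $M$, $$N_T(X,Y) = [TX,TY] - T[TX,Y] - T[X,TY] + T^2[X,Y] = 0.$$ -/

import Mathlib

open scoped Manifold ContDiff Bundle
open Bundle

set_option linter.unusedSectionVars false

noncomputable section

namespace MetallicGeometry

/-! ## Vector fields, Levi-Civita connections and metallic Riemannian structures -/

section Ambient

variable {E : Type*} [NormedAddCommGroup E] [NormedSpace ℝ E] [FiniteDimensional ℝ E]
  {H : Type*} [TopologicalSpace H] {I : ModelWithCorners ℝ E H}
  {M : Type*} [TopologicalSpace M] [ChartedSpace H M]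

instance instFiniteDimensionalTangentSpace (x : M) : FiniteDimensional ℝ (TangentSpace I x) :=
  inferInstanceAs (FiniteDimensional ℝ E)

/-- `X ∈ Γ(TM)`: `X` is a smooth vector field on `M`. -/
def IsSmoothVectorField [IsManifold I ∞ M] (X : Π x : M, TangentSpace I x) : Prop :=
  ContMDiff I I.tangent ∞ (fun x ↦ (⟨x, X x⟩ : TangentBundle I M))

/-- A smooth tensor field of type `(1,1)`: a smooth section of the endomorphism bundle of `TM`. -/
def IsSmoothEndomorphismField [IsManifold I ∞ M]
    (J : Π x : M, TangentSpace I x →L[ℝ] TangentSpace I x) : Prop :=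
  ContMDiff I (I.prod 𝓘(ℝ, E →L[ℝ] E)) ∞
    (fun x ↦ (⟨x, J x⟩ : Bundle.TotalSpace (E →L[ℝ] E)
      (fun x : M ↦ TangentSpace I x →L[ℝ] TangentSpace I x)))

/-- The Nijenhuis tensor field
`N_T(X, Y) = [TX, TY] - T[TX, Y] - T[X, TY] + T²[X, Y]` of an endomorphism field `T`. -/
def nijenhuis (T : Π x : M, TangentSpace I x →L[ℝ] TangentSpace I x)
    (X Y : Π x : M, TangentSpace I x) (x : M) : TangentSpace I x :=
  VectorField.mlieBracket I (fun z ↦ T z (X z)) (fun z ↦ T z (Y z)) x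
    - T x (VectorField.mlieBracket I (fun z ↦ T z (X z)) Y x)
    - T x (VectorField.mlieBracket I X (fun z ↦ T z (Y z)) x)
    + T x (T x (VectorField.mlieBracket I X Y x))

variable [IsManifold I ∞ M] [RiemannianBundle (fun x : M ↦ TangentSpace I x)]

/-- `cov` is the Levi-Civita connection of the Riemannian metric of `M`: it is compatible with the
metric, `X⟨Y, Z⟩ = ⟨∇_X Y, Z⟩ + ⟨Y, ∇_X Z⟩`, and torsion free. In Mathlib's argument order
`cov Y x u` is `∇_u Y`. -/
structure IsLeviCivita (cov : CovariantDerivative I E (fun x : M ↦ TangentSpace I x)) : Prop where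
  metric : ∀ (x : M) (Y Z : Π x : M, TangentSpace I x),
    MDifferentiableAt I I.tangent (fun z ↦ (⟨z, Y z⟩ : TangentBundle I M)) x →
    MDifferentiableAt I I.tangent (fun z ↦ (⟨z, Z z⟩ : TangentBundle I M)) x →
    ∀ u : TangentSpace I x,
      mvfderiv I (fun z ↦ inner ℝ (Y z) (Z z)) x u
        = inner ℝ (cov Y x u) (Z x) + inner ℝ (Y x) (cov Z x u)
  torsion_free : cov.torsion = 0

/-- `(J, g)` is a metallic Riemannian structure on `M`, where `g` is the Riemannian metric of `M`:
`J` is a smooth `(1,1)`-tensor field with `J² = pJ + qI` for positive integers `p`, `q`,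
and `g(JX, Y) = g(X, JY)`. -/
structure IsMetallicRiemannian (p q : ℕ)
    (J : Π x : M, TangentSpace I x →L[ℝ] TangentSpace I x) : Prop where
  p_pos : 0 < p
  q_pos : 0 < q
  smooth : IsSmoothEndomorphismField J
  sq : ∀ (x : M) (u : TangentSpace I x), J x (J x u) = (p : ℝ) • J x u + (q : ℝ) • u
  symm : ∀ (x : M) (u v : TangentSpace I x), inner ℝ (J x u) v = inner ℝ u (J x v)

/-- `∇` is a `J`-connection, i.e. `∇J = 0`, where `(∇_u J) Y = ∇_u (JY) - J (∇_u Y)`. -/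
def IsJConnection (cov : CovariantDerivative I E (fun x : M ↦ TangentSpace I x))
    (J : Π x : M, TangentSpace I x →L[ℝ] TangentSpace I x) : Prop :=
  ∀ (x : M) (Y : Π x : M, TangentSpace I x),
    MDifferentiableAt I I.tangent (fun z ↦ (⟨z, Y z⟩ : TangentBundle I M)) x →
    ∀ u : TangentSpace I x, cov (fun z ↦ J z (Y z)) x u - J x (cov Y x u) = 0

/-- `(M, J, g)`, with Levi-Civita connection `cov`, is a locally metallic Riemannian manifold. -/
structure IsLocallyMetallicRiemannian (p q : ℕ)
    (J : Π x : M, TangentSpace I x →L[ℝ] TangentSpace I x)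
    (cov : CovariantDerivative I E (fun x : M ↦ TangentSpace I x)) : Prop where
  metallic : IsMetallicRiemannian p q J
  leviCivita : IsLeviCivita cov
  parallel : IsJConnection cov J

end Ambient

/-! ## Isometrically immersed submanifolds -/

section Submanifold

variable {E : Type*} [NormedAddCommGroup E] [NormedSpace ℝ E] [FiniteDimensional ℝ E]
  {H : Type*} [TopologicalSpace H] (I : ModelWithCorners ℝ E H)
  {M : Type*} [TopologicalSpace M] [ChartedSpace H M] [IsManifold I ∞ M]
  {E' : Type*} [NormedAddCommGroup E'] [NormedSpace ℝ E'] [FiniteDimensional ℝ E']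
  {H' : Type*} [TopologicalSpace H'] (I' : ModelWithCorners ℝ E' H')
  {M' : Type*} [TopologicalSpace M'] [ChartedSpace H' M'] [IsManifold I' ∞ M']
  (f : M → M')

/-- Differentiability at `x` of a vector field `V` along `f`, i.e. of a section of `f^*TM'`. -/
def MDiffAlongAt (V : Π x : M, TangentSpace I' (f x)) (x : M) : Prop :=
  MDifferentiableAt I I'.tangent (fun z ↦ (⟨f z, V z⟩ : TangentBundle I' M')) x

variable {I'} in
/-- The connection `f^*∇` on `f^*TM'` induced by a connection `∇` on `TM'`: `covAlong I cov f V x u`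
is the covariant derivative `∇_u V` of the vector field `V` along `f` in the direction
`u ∈ T_xM`. If `(e_i)` is the frame given by the preferred trivialization of `TM'` at `f x`
and `V = ∑ V^i (e_i ∘ f)`, this is `∑ u(V^i) e_i(f x) + ∑ V^i(x) ∇_{df(u)} e_i`. Note that
`FiberBundle.extend E' (V x)` is the local vector field `∑ V^i(x) e_i`. -/
def covAlong (cov : CovariantDerivative I' E' (fun y : M' ↦ TangentSpace I' y))
    (V : Π x : M, TangentSpace I' (f x)) (x : M) :
    TangentSpace I x →L[ℝ] TangentSpace I' (f x) :=
  ((trivializationAt E' (fun y : M' ↦ TangentSpace I' y) (f x)).symmL ℝ (f x)) ∘L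
      (mvfderiv I (fun z ↦ (trivializationAt E' (fun y : M' ↦ TangentSpace I' y) (f x)
        (⟨f z, V z⟩ : TangentBundle I' M')).2) x)
    + (cov (FiberBundle.extend E' (E := fun y : M' ↦ TangentSpace I' y) (V x)) (f x)) ∘L
      (mfderiv I I' f x)

/-- The vector field `df(Y)` along `f`. -/
def pushField (Y : Π x : M, TangentSpace I x) (x : M) : TangentSpace I' (f x) :=
  mfderiv I I' f x (Y x)

section Lemmas

variable {I I' f}

theorem cov_extend_add (cov : CovariantDerivative I' E' (fun y : M' ↦ TangentSpace I' y)) {y : M'}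
    (v w : TangentSpace I' y) :
    cov (FiberBundle.extend E' (E := fun y : M' ↦ TangentSpace I' y) (v + w)) y
      = cov (FiberBundle.extend E' (E := fun y : M' ↦ TangentSpace I' y) v) y
        + cov (FiberBundle.extend E' (E := fun y : M' ↦ TangentSpace I' y) w) y := by
  rw [← cov.isCovariantDerivativeOn.add (FiberBundle.mdifferentiableAt_extend ..)
    (FiberBundle.mdifferentiableAt_extend ..)]
  refine cov.isCovariantDerivativeOnUniv.congr_of_eventuallyEq
    (FiberBundle.mdifferentiableAt_extend ..) (mdifferentiableAt_add_section
      (FiberBundle.mdifferentiableAt_extend ..) (FiberBundle.mdifferentiableAt_extend ..))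
    Filter.univ_mem ?_
  filter_upwards [(trivializationAt E' (fun y : M' ↦ TangentSpace I' y) y).open_baseSet.mem_nhds
    (FiberBundle.mem_baseSet_trivializationAt' y)] with z hz
  have h := ((trivializationAt E' (fun y : M' ↦ TangentSpace I' y) y).linear ℝ
    (FiberBundle.mem_baseSet_trivializationAt' y)).map_add v w
  have h' := ((trivializationAt E' (fun y : M' ↦ TangentSpace I' y) y).symmₗ ℝ z).map_add
    ((trivializationAt E' (fun y : M' ↦ TangentSpace I' y) y) ⟨y, v⟩).2
    ((trivializationAt E' (fun y : M' ↦ TangentSpace I' y) y) ⟨y, w⟩).2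
  simp only [FiberBundle.extend, Pi.add_apply]
  rw [h]
  rwa [Bundle.Trivialization.coe_symmₗ _ hz] at h'

theorem cov_extend_smul (cov : CovariantDerivative I' E' (fun y : M' ↦ TangentSpace I' y)) {y : M'}
    (c : ℝ) (v : TangentSpace I' y) :
    cov (FiberBundle.extend E' (E := fun y : M' ↦ TangentSpace I' y) (c • v)) y
      = c • cov (FiberBundle.extend E' (E := fun y : M' ↦ TangentSpace I' y) v) y := by
  rw [← cov.isCovariantDerivativeOn.smul_const c (FiberBundle.mdifferentiableAt_extend ..)]
  refine cov.isCovariantDerivativeOnUniv.congr_of_eventuallyEq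
    (FiberBundle.mdifferentiableAt_extend ..)
    (MDifferentiableAt.smul_const_section (FiberBundle.mdifferentiableAt_extend ..))
    Filter.univ_mem ?_
  filter_upwards [(trivializationAt E' (fun y : M' ↦ TangentSpace I' y) y).open_baseSet.mem_nhds
    (FiberBundle.mem_baseSet_trivializationAt' y)] with z hz
  have h := ((trivializationAt E' (fun y : M' ↦ TangentSpace I' y) y).linear ℝ
    (FiberBundle.mem_baseSet_trivializationAt' y)).map_smul c v
  have h' := ((trivializationAt E' (fun y : M' ↦ TangentSpace I' y) y).symmₗ ℝ z).map_smul c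
    ((trivializationAt E' (fun y : M' ↦ TangentSpace I' y) y) ⟨y, v⟩).2
  simp only [FiberBundle.extend, Pi.smul_apply]
  rw [h]
  rwa [Bundle.Trivialization.coe_symmₗ _ hz] at h'

theorem MDiffAlongAt.eventually_mem_baseSet {V : Π x : M, TangentSpace I' (f x)} {x : M}
    (hV : MDiffAlongAt I I' f V x) :
    ∀ᶠ z in nhds x, f z ∈ (trivializationAt E' (fun y : M' ↦ TangentSpace I' y) (f x)).baseSet :=
  ((mdifferentiableAt_totalSpace I' _).1 hV).1.continuousAt
    ((trivializationAt E' (fun y : M' ↦ TangentSpace I' y) (f x)).open_baseSet.mem_nhds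
      (FiberBundle.mem_baseSet_trivializationAt' (f x)))

theorem covAlong_add (cov : CovariantDerivative I' E' (fun y : M' ↦ TangentSpace I' y))
    {V W : Π x : M, TangentSpace I' (f x)} {x : M}
    (hV : MDiffAlongAt I I' f V x) (hW : MDiffAlongAt I I' f W x) :
    covAlong I f cov (V + W) x = covAlong I f cov V x + covAlong I f cov W x := by
  have h1 : mvfderiv I (fun z ↦ (trivializationAt E' (fun y : M' ↦ TangentSpace I' y) (f x)
        (⟨f z, (V + W) z⟩ : TangentBundle I' M')).2) x
      = mvfderiv I (fun z ↦ (trivializationAt E' (fun y : M' ↦ TangentSpace I' y) (f x)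
          (⟨f z, V z⟩ : TangentBundle I' M')).2) x
        + mvfderiv I (fun z ↦ (trivializationAt E' (fun y : M' ↦ TangentSpace I' y) (f x)
          (⟨f z, W z⟩ : TangentBundle I' M')).2) x := by
    rw [← mvfderiv_fun_add ((mdifferentiableAt_totalSpace I' _).1 hV).2
      ((mdifferentiableAt_totalSpace I' _).1 hW).2]
    have hev : (fun z ↦ (trivializationAt E' (fun y : M' ↦ TangentSpace I' y) (f x)
        (⟨f z, (V + W) z⟩ : TangentBundle I' M')).2) =ᶠ[nhds x]
        fun z ↦ (trivializationAt E' (fun y : M' ↦ TangentSpace I' y) (f x)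
          (⟨f z, V z⟩ : TangentBundle I' M')).2
          + (trivializationAt E' (fun y : M' ↦ TangentSpace I' y) (f x)
          (⟨f z, W z⟩ : TangentBundle I' M')).2 := by
      filter_upwards [hV.eventually_mem_baseSet] with z hz
      exact ((trivializationAt E' (fun y : M' ↦ TangentSpace I' y) (f x)).linear ℝ hz).map_add
        (V z) (W z)
    simp only [mvfderiv]
    rw [hev.mfderiv_eq, hev.eq_of_nhds]
    rfl
  have h2 := cov_extend_add cov (V x) (W x)
  unfold covAlong
  rw [h1, Pi.add_apply, h2, ContinuousLinearMap.comp_add, ContinuousLinearMap.add_comp]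
  abel

theorem covAlong_smul (cov : CovariantDerivative I' E' (fun y : M' ↦ TangentSpace I' y))
    {V : Π x : M, TangentSpace I' (f x)} {φ : M → ℝ} {x : M}
    (hφ : MDifferentiableAt I 𝓘(ℝ, ℝ) φ x) (hV : MDiffAlongAt I I' f V x) :
    covAlong I f cov (fun z ↦ φ z • V z) x
      = φ x • covAlong I f cov V x + (mvfderiv I φ x).smulRight (V x) := by
  have h1 : mvfderiv I (fun z ↦ (trivializationAt E' (fun y : M' ↦ TangentSpace I' y) (f x)
        (⟨f z, φ z • V z⟩ : TangentBundle I' M')).2) x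
      = φ x • mvfderiv I (fun z ↦ (trivializationAt E' (fun y : M' ↦ TangentSpace I' y) (f x)
          (⟨f z, V z⟩ : TangentBundle I' M')).2) x
        + (mvfderiv I φ x).smulRight (trivializationAt E' (fun y : M' ↦ TangentSpace I' y) (f x)
          (⟨f x, V x⟩ : TangentBundle I' M')).2 := by
    rw [← mvfderiv_fun_smul hφ ((mdifferentiableAt_totalSpace I' _).1 hV).2]
    have hev : (fun z ↦ (trivializationAt E' (fun y : M' ↦ TangentSpace I' y) (f x)
        (⟨f z, φ z • V z⟩ : TangentBundle I' M')).2) =ᶠ[nhds x]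
        fun z ↦ φ z • (trivializationAt E' (fun y : M' ↦ TangentSpace I' y) (f x)
          (⟨f z, V z⟩ : TangentBundle I' M')).2 := by
      filter_upwards [hV.eventually_mem_baseSet] with z hz
      exact ((trivializationAt E' (fun y : M' ↦ TangentSpace I' y) (f x)).linear ℝ hz).map_smul
        (φ z) (V z)
    simp only [mvfderiv]
    rw [hev.mfderiv_eq, hev.eq_of_nhds]
    rfl
  have h2 := cov_extend_smul cov (φ x) (V x)
  unfold covAlong
  rw [h1, h2]
  have h3 : (trivializationAt E' (fun y : M' ↦ TangentSpace I' y) (f x)).symmL ℝ (f x)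
      (trivializationAt E' (fun y : M' ↦ TangentSpace I' y) (f x)
        (⟨f x, V x⟩ : TangentBundle I' M')).2 = V x := by
    rw [Bundle.Trivialization.symmL_apply _ (FiberBundle.mem_baseSet_trivializationAt' (f x))]
    exact Bundle.Trivialization.symm_apply_apply_mk _
      (FiberBundle.mem_baseSet_trivializationAt' (f x)) (V x)
  ext u
  simp only [add_apply, ContinuousLinearMap.comp_apply,
    smul_apply, ContinuousLinearMap.smulRight_apply, map_add, map_smul, h3]
  module

theorem mdiffAlongAt_pushField (hf : ContMDiff I I' ∞ f) {Y : Π x : M, TangentSpace I x} {x : M}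
    (hY : MDifferentiableAt I I.tangent (fun z ↦ (⟨z, Y z⟩ : TangentBundle I M)) x) :
    MDiffAlongAt I I' f (pushField I I' f Y) x := by
  have h : ContMDiff I.tangent I'.tangent 1 (tangentMap I I' f) :=
    (hf.of_le (ENat.LEInfty.out : (2 : ℕ∞ω) ≤ ∞)).contMDiff_tangentMap (by norm_num)
  exact (h.mdifferentiableAt one_ne_zero).comp x hY

end Lemmas

variable [RiemannianBundle (fun y : M' ↦ TangentSpace I' y)]

/-- The tangent space `T_xM`, seen in `T_{f x}M'`. -/
def tangentImage (x : M) : Submodule ℝ (TangentSpace I' (f x)) :=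
  (mfderiv I I' f x).range

/-- The normal space `T_xM^⊥ ⊆ T_{f x}M'`. -/
def normalSpace (x : M) : Submodule ℝ (TangentSpace I' (f x)) :=
  (tangentImage I I' f x)ᗮ

/-- The normal component `w^⊥` of `w ∈ T_{f x}M'`. -/
def normalPart (x : M) : TangentSpace I' (f x) →L[ℝ] TangentSpace I' (f x) :=
  (normalSpace I I' f x).starProjection

/-- `f` is an isometric immersion: smooth, with `⟨df u, df v⟩ = ⟨u, v⟩`, so that the Riemannian
metric of `M` is the induced one. (This makes each `df_x` injective.) -/
structure IsIsometricImmersion [RiemannianBundle (fun x : M ↦ TangentSpace I x)] : Prop where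
  smooth : ContMDiff I I' ∞ f
  isometric : ∀ (x : M) (u v : TangentSpace I x),
    inner ℝ (mfderiv I I' f x u) (mfderiv I I' f x v) = inner ℝ u v

variable {I I' f}

theorem normalPart_apply_tangent (x : M) (u : TangentSpace I x) :
    normalPart I I' f x (mfderiv I I' f x u) = 0 := by
  refine (Submodule.starProjection_apply_eq_zero_iff _).2 ?_
  exact Submodule.le_orthogonal_orthogonal _ ⟨u, rfl⟩

theorem tensorialAt_normalPart_covAlong (hf : ContMDiff I I' ∞ f)
    (cov : CovariantDerivative I' E' (fun y : M' ↦ TangentSpace I' y)) (x : M) :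
    TensorialAt I E (fun Y : Π x : M, TangentSpace I x ↦
      normalPart I I' f x ∘L covAlong I f cov (pushField I I' f Y) x) x where
  smul {φ Y} hφ hY := by
    have h : pushField I I' f (φ • Y) = fun z ↦ φ z • pushField I I' f Y z := by
      funext z
      exact (mfderiv I I' f z).map_smul (φ z) (Y z)
    have h0 : normalPart I I' f x (pushField I I' f Y x) = 0 :=
      normalPart_apply_tangent x (Y x)
    rw [h, covAlong_smul cov hφ (mdiffAlongAt_pushField hf hY)]
    ext u
    simp [h0]
  add {Y Z} hY hZ := by
    have h : pushField I I' f (Y + Z) = pushField I I' f Y + pushField I I' f Z := by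
      funext z
      exact (mfderiv I I' f z).map_add (Y z) (Z z)
    rw [h, covAlong_add cov (mdiffAlongAt_pushField hf hY) (mdiffAlongAt_pushField hf hZ),
      ContinuousLinearMap.comp_add]

variable [RiemannianBundle (fun x : M ↦ TangentSpace I x)]

/-- The second fundamental form `h(u, v) = (∇_u V)^⊥ ∈ T_xM^⊥`, where `∇` is the connection `cov`
of the ambient manifold and `V` is any vector field on `M` extending `v`. -/
def secondFundamentalForm (hf : ContMDiff I I' ∞ f)
    (cov : CovariantDerivative I' E' (fun y : M' ↦ TangentSpace I' y)) (x : M) :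
    TangentSpace I x →L[ℝ] TangentSpace I x →L[ℝ] TangentSpace I' (f x) :=
  (TensorialAt.mkHom (fun Y : Π x : M, TangentSpace I x ↦
      normalPart I I' f x ∘L covAlong I f cov (pushField I I' f Y) x) x
    (tensorialAt_normalPart_covAlong hf cov x)).flip

/-- The defining property of the second fundamental form: `h(X, Y) = (∇_X Y)^⊥`. -/
theorem secondFundamentalForm_apply (hf : ContMDiff I I' ∞ f)
    (cov : CovariantDerivative I' E' (fun y : M' ↦ TangentSpace I' y)) {x : M}
    {Y : Π x : M, TangentSpace I x}
    (hY : MDifferentiableAt I I.tangent (fun z ↦ (⟨z, Y z⟩ : TangentBundle I M)) x)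
    (u : TangentSpace I x) :
    secondFundamentalForm hf cov x u (Y x)
      = normalPart I I' f x (covAlong I f cov (pushField I I' f Y) x u) := by
  have h := TensorialAt.mkHom_apply (tensorialAt_normalPart_covAlong hf cov x) hY
  exact congrArg (fun L ↦ L u) h

/-- The shape operator `A_ξ` at `x` in the direction `ξ`, given by `g(A_ξ u, v) = g(h(u, v), ξ)`. -/
def shapeOperator (hf : ContMDiff I I' ∞ f)
    (cov : CovariantDerivative I' E' (fun y : M' ↦ TangentSpace I' y)) (x : M)
    (ξ : TangentSpace I' (f x)) : TangentSpace I x →L[ℝ] TangentSpace I x :=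
  haveI : CompleteSpace (TangentSpace I x) := FiniteDimensional.complete ℝ _
  InnerProductSpace.continuousLinearMapOfBilin (𝕜 := ℝ)
    ((ContinuousLinearMap.compL ℝ (TangentSpace I x) (TangentSpace I' (f x)) ℝ
      (innerSL ℝ ξ)) ∘L secondFundamentalForm hf cov x)

theorem inner_shapeOperator (hf : ContMDiff I I' ∞ f)
    (cov : CovariantDerivative I' E' (fun y : M' ↦ TangentSpace I' y)) (x : M)
    (ξ : TangentSpace I' (f x)) (u v : TangentSpace I x) :
    inner ℝ (shapeOperator hf cov x ξ u) v = inner ℝ (secondFundamentalForm hf cov x u v) ξ := by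
  have : CompleteSpace (TangentSpace I x) := FiniteDimensional.complete ℝ _
  rw [shapeOperator, InnerProductSpace.continuousLinearMapOfBilin_apply, real_inner_comm]
  rfl

variable (I I' f) in
/-- The tangential component `w^T ∈ T_xM` of `w ∈ T_{f x}M'`, as the adjoint of `df_x`. When `df_x`
is isometric, `df_x (w^T)` is the orthogonal projection of `w` to `df_x (T_xM)`. -/
def tangentialPart (x : M) : TangentSpace I' (f x) →L[ℝ] TangentSpace I x :=
  haveI : CompleteSpace (TangentSpace I x) := FiniteDimensional.complete ℝ _
  haveI : CompleteSpace (TangentSpace I' (f x)) := FiniteDimensional.complete ℝ _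
  ContinuousLinearMap.adjoint (mfderiv I I' f x)

/-- Every `w ∈ T_{f x}M'` is the sum of its tangential and its normal component. -/
theorem tangentialPart_add_normalPart (hf : IsIsometricImmersion I I' f) (x : M)
    (w : TangentSpace I' (f x)) :
    mfderiv I I' f x (tangentialPart I I' f x w) + normalPart I I' f x w = w := by
  have : CompleteSpace (TangentSpace I x) := FiniteDimensional.complete ℝ _
  have : CompleteSpace (TangentSpace I' (f x)) := FiniteDimensional.complete ℝ _
  have h : normalPart I I' f x w = w - mfderiv I I' f x (tangentialPart I I' f x w) := by
    refine Submodule.eq_starProjection_of_mem_of_inner_eq_zero ?_ ?_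
    · rw [normalSpace, Submodule.mem_orthogonal]
      rintro _ ⟨u, rfl⟩
      have h1 : inner ℝ (mfderiv I I' f x u) w = inner ℝ u (tangentialPart I I' f x w) :=
        (ContinuousLinearMap.adjoint_inner_right (mfderiv I I' f x) u w).symm
      have h2 := hf.isometric x u (tangentialPart I I' f x w)
      exact (inner_sub_right _ _ _).trans (sub_eq_zero.2 (h1.trans h2.symm))
    · intro v hv
      rw [sub_sub_cancel]
      exact (Submodule.mem_orthogonal _ _).1 hv _ ⟨_, rfl⟩
  rw [h]
  abel

variable (I f) in
/-- The endomorphism field `T` of `TM` induced by `J`: `TX = (JX)^T`. -/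
def inducedT (J : Π y : M', TangentSpace I' y →L[ℝ] TangentSpace I' y) (x : M) :
    TangentSpace I x →L[ℝ] TangentSpace I x :=
  tangentialPart I I' f x ∘L J (f x) ∘L mfderiv I I' f x

variable (I f) in
/-- The submanifold is invariant: `J(T_xM) ⊆ T_xM` for every `x`. -/
def IsInvariant (J : Π y : M', TangentSpace I' y →L[ℝ] TangentSpace I' y) : Prop :=
  ∀ x : M, ∀ w ∈ tangentImage I I' f x, J (f x) w ∈ tangentImage I I' f x

variable (I I' f) in
/-- `(N_1, …, N_r)` are smooth normal vector fields on the open set `U ⊆ M` which form an orthonormal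
basis of the normal space at each point of `U`. -/
structure IsOrthonormalNormalFrameOn {r : ℕ} (N : Fin r → Π x : M, TangentSpace I' (f x))
    (U : Set M) : Prop where
  isOpen : IsOpen U
  smooth : ∀ α, ContMDiffOn I I'.tangent ∞ (fun x ↦ (⟨f x, N α x⟩ : TangentBundle I' M')) U
  orthonormal : ∀ x ∈ U, Orthonormal ℝ (fun α ↦ N α x)
  span : ∀ x ∈ U, Submodule.span ℝ (Set.range fun α ↦ N α x) = normalSpace I I' f x

end Submanifold

end MetallicGeometry

end

open MetallicGeometry

noncomputable section

namespace MetallicGeometry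

open Filter Topology

section Calculus

variable {E : Type*} [NormedAddCommGroup E] [NormedSpace ℝ E]
  {H : Type*} [TopologicalSpace H] {I : ModelWithCorners ℝ E H}
  {M : Type*} [TopologicalSpace M] [ChartedSpace H M]
  {F : Type*} [NormedAddCommGroup F] [NormedSpace ℝ F]
  {F' : Type*} [NormedAddCommGroup F'] [NormedSpace ℝ F']

theorem mvfderiv_clm_apply {A : M → F →L[ℝ] F'} {w : M → F} {x : M}
    (hA : MDifferentiableAt I 𝓘(ℝ, F →L[ℝ] F') A x) (hw : MDifferentiableAt I 𝓘(ℝ, F) w x)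
    (u : TangentSpace I x) :
    mvfderiv I (fun z ↦ A z (w z)) x u
      = A x (mvfderiv I w x u) + mvfderiv I A x u (w x) := by
  let A' : E →L[ℝ] F →L[ℝ] F' := mvfderiv I A x
  let w' : E →L[ℝ] F := mvfderiv I w x
  have h : HasMFDerivAt I 𝓘(ℝ, F') (fun z ↦ A z (w z)) x (A x ∘L w' + A'.flip (w x)) := by
    refine ⟨hA.continuousAt.clm_apply hw.continuousAt, ?_⟩
    have h := hA.hasMFDerivAt.2.clm_apply hw.hasMFDerivAt.2
    convert! h using 1
    simp
    rfl
  exact congrArg (fun L ↦ L u) h.mfderiv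

theorem mvfderiv_congr {g g' : M → F} {x : M} (h : g =ᶠ[𝓝 x] g') :
    mvfderiv I g x = mvfderiv I g' x := by
  simp only [mvfderiv]
  rw [h.mfderiv_eq, h.eq_of_nhds]

variable [IsManifold I ∞ M] [FiniteDimensional ℝ E] [I.Boundaryless]

/-- A vector field on `M`, read in the preferred chart at `x`. -/
def fieldInChart (I : ModelWithCorners ℝ E H) (x : M) (Y : Π x : M, TangentSpace I x) : E → E :=
  VectorField.mpullbackWithin 𝓘(ℝ, E) I (extChartAt I x).symm Y (Set.range I)

theorem fderiv_comp_extChartAt_symm_fieldInChart {G : M → F} {x : M} {p : E}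
    (hp : p ∈ (extChartAt I x).target)
    (hG : MDifferentiableAt I 𝓘(ℝ, F) G ((extChartAt I x).symm p))
    (Y : Π x : M, TangentSpace I x) :
    fderiv ℝ (G ∘ (extChartAt I x).symm) p (fieldInChart I x Y p)
      = mvfderiv I G ((extChartAt I x).symm p) (Y ((extChartAt I x).symm p)) := by
  have hinv := isInvertible_mfderivWithin_extChartAt_symm (I := I) hp
  have hs := mdifferentiableWithinAt_extChartAt_symm (I := I) hp
  unfold fieldInChart
  rw [I.range_eq_univ] at hinv hs ⊢
  rw [mfderivWithin_univ] at hinv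
  rw [mdifferentiableWithinAt_univ] at hs
  rw [← mfderiv_eq_fderiv, mfderiv_comp p hG hs, VectorField.mpullbackWithin_apply,
    mfderivWithin_univ]
  exact congrArg (mfderiv I 𝓘(ℝ, F) G ((extChartAt I x).symm p)) (hinv.self_apply_inverse _)

theorem mvfderiv_eq_fderiv_fieldInChart {G : M → F} {x z : M}
    (hz : z ∈ (extChartAt I x).source) (hG : MDifferentiableAt I 𝓘(ℝ, F) G z)
    (Y : Π x : M, TangentSpace I x) :
    mvfderiv I G z (Y z) = fderiv ℝ (G ∘ (extChartAt I x).symm) (extChartAt I x z)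
      (fieldInChart I x Y (extChartAt I x z)) := by
  have hl : (extChartAt I x).symm (extChartAt I x z) = z := (extChartAt I x).left_inv hz
  rw [fderiv_comp_extChartAt_symm_fieldInChart ((extChartAt I x).map_source hz)
    (hl.symm ▸ hG), hl]

theorem differentiableAt_fieldInChart {x : M} {Y : Π x : M, TangentSpace I x}
    (hY : MDifferentiableAt I I.tangent (fun z ↦ (⟨z, Y z⟩ : TangentBundle I M)) x) :
    DifferentiableAt ℝ (fieldInChart I x Y) (extChartAt I x x) := by
  have h := MDifferentiableWithinAt.differentiableWithinAt_mpullbackWithin_vectorField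
    (mdifferentiableWithinAt_univ.2 hY)
  rw [Set.preimage_univ, Set.univ_inter] at h
  refine DifferentiableWithinAt.differentiableAt (s := Set.range I) h ?_
  rw [I.range_eq_univ]
  exact univ_mem

theorem contDiffAt_comp_extChartAt_symm {G : M → F} {x : M} (hG : ContMDiffAt I 𝓘(ℝ, F) 2 G x) :
    ContDiffAt ℝ 2 (G ∘ (extChartAt I x).symm) (extChartAt I x x) := by
  have h := (contMDiffAt_iff.1 hG).2
  rw [I.range_eq_univ, contDiffWithinAt_univ] at h
  exact h

theorem mvfderiv_apply_eventuallyEq {G : M → F} {x : M} (hG : ContMDiffAt I 𝓘(ℝ, F) 2 G x)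
    (Y : Π x : M, TangentSpace I x) :
    (fun z ↦ mvfderiv I G z (Y z)) =ᶠ[𝓝 x] (fun p ↦ fderiv ℝ (G ∘ (extChartAt I x).symm) p
      (fieldInChart I x Y p)) ∘ extChartAt I x := by
  filter_upwards [(contMDiffAt_iff_contMDiffAt_nhds (by simp)).1 hG,
    extChartAt_source_mem_nhds (I := I) x] with z hz hz'
  exact mvfderiv_eq_fderiv_fieldInChart hz' (hz.mdifferentiableAt two_ne_zero) Y

theorem mdifferentiableAt_mvfderiv_apply {G : M → F} {x : M}
    (hG : ContMDiffAt I 𝓘(ℝ, F) 2 G x) {Y : Π x : M, TangentSpace I x}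
    (hY : MDifferentiableAt I I.tangent (fun z ↦ (⟨z, Y z⟩ : TangentBundle I M)) x) :
    MDifferentiableAt I 𝓘(ℝ, F) (fun z ↦ mvfderiv I G z (Y z)) x := by
  have hdG := ((contDiffAt_comp_extChartAt_symm hG).fderiv_right
    (m := 1) (by norm_num)).differentiableAt one_ne_zero
  exact (MDifferentiableAt.comp x
    (hdG.clm_apply (differentiableAt_fieldInChart hY)).mdifferentiableAt
    (mdifferentiableAt_extChartAt (mem_chart_source H x))).congr_of_eventuallyEq
    (mvfderiv_apply_eventuallyEq hG Y)

theorem mvfderiv_mvfderiv_apply {G : M → F} {x : M}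
    (hG : ContMDiffAt I 𝓘(ℝ, F) 2 G x) {Y : Π x : M, TangentSpace I x}
    (hY : MDifferentiableAt I I.tangent (fun z ↦ (⟨z, Y z⟩ : TangentBundle I M)) x)
    (X : Π x : M, TangentSpace I x) :
    letI G' := G ∘ (extChartAt I x).symm
    letI p := extChartAt I x x
    mvfderiv I (fun z ↦ mvfderiv I G z (Y z)) x (X x)
      = fderiv ℝ G' p (fderiv ℝ (fieldInChart I x Y) p (fieldInChart I x X p))
        + fderiv ℝ (fderiv ℝ G') p (fieldInChart I x X p) (fieldInChart I x Y p) := by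
  have hdG := ((contDiffAt_comp_extChartAt_symm hG).fderiv_right
    (m := 1) (by norm_num)).differentiableAt one_ne_zero
  have hx := mem_extChartAt_source (I := I) x
  have he : (fun z ↦ mvfderiv I G z (Y z)) ∘ (extChartAt I x).symm =ᶠ[𝓝 (extChartAt I x x)]
      fun p ↦ fderiv ℝ (G ∘ (extChartAt I x).symm) p (fieldInChart I x Y p) := by
    have hc := continuousAt_extChartAt_symm (I := I) x
    have h := mvfderiv_apply_eventuallyEq hG Y
    rw [ContinuousAt, extChartAt_to_inv] at hc
    filter_upwards [hc.eventually h, extChartAt_target_mem_nhds (I := I) x] with p hp hp'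
    exact hp.trans (by simp only [Function.comp_apply]; rw [(extChartAt I x).right_inv hp'])
  rw [mvfderiv_eq_fderiv_fieldInChart hx (mdifferentiableAt_mvfderiv_apply hG hY) X,
    he.fderiv_eq, fderiv_clm_apply hdG (differentiableAt_fieldInChart hY)]
  rfl

theorem mvfderiv_mlieBracket_eq_fderiv {G : M → F} {x : M}
    (hG : ContMDiffAt I 𝓘(ℝ, F) 2 G x) (X Y : Π x : M, TangentSpace I x) :
    mvfderiv I G x (VectorField.mlieBracket I X Y x)
      = fderiv ℝ (G ∘ (extChartAt I x).symm) (extChartAt I x x)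
        (VectorField.lieBracket ℝ (fieldInChart I x X) (fieldInChart I x Y) (extChartAt I x x)) := by
  have hx := mem_extChartAt_source (I := I) x
  have he : G =ᶠ[𝓝 x] (G ∘ (extChartAt I x).symm) ∘ extChartAt I x := by
    filter_upwards [extChartAt_source_mem_nhds (I := I) x] with z hz
    simp only [Function.comp_apply]
    rw [(extChartAt I x).left_inv hz]
  have hd := ((contDiffAt_comp_extChartAt_symm hG).differentiableAt two_ne_zero).mdifferentiableAt
  have hc := mfderiv_comp x hd
    (mdifferentiableAt_extChartAt (I := I) (mem_chart_source H x))
  let w : E := VectorField.lieBracket ℝ (fieldInChart I x X) (fieldInChart I x Y) (extChartAt I x x)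
  have hw : VectorField.lieBracketWithin ℝ (fieldInChart I x X) (fieldInChart I x Y)
      ((extChartAt I x).symm ⁻¹' Set.univ ∩ Set.range I) (extChartAt I x x) = w := by
    rw [Set.preimage_univ, Set.univ_inter, I.range_eq_univ, VectorField.lieBracketWithin_univ]
  have hb : VectorField.mlieBracket I X Y x = (mfderiv I 𝓘(ℝ, E) (extChartAt I x) x).inverse w :=
    congrArg (mfderiv I 𝓘(ℝ, E) (extChartAt I x) x).inverse hw
  rw [mvfderiv_congr he, hb]
  have hi := (isInvertible_mfderiv_extChartAt (I := I) hx).self_apply_inverse w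
  refine (DFunLike.congr_fun hc _).trans ?_
  refine (congrArg (mfderiv 𝓘(ℝ, E) 𝓘(ℝ, F) (G ∘ (extChartAt I x).symm) (extChartAt I x x))
    hi).trans ?_
  rw [mfderiv_eq_fderiv]
  rfl

/-- The Lie bracket is the commutator of derivations: `[X, Y] G = X (Y G) - Y (X G)`. -/
theorem mvfderiv_mlieBracket {G : M → F} {x : M}
    (hG : ContMDiffAt I 𝓘(ℝ, F) 2 G x) {X Y : Π x : M, TangentSpace I x}
    (hX : MDifferentiableAt I I.tangent (fun z ↦ (⟨z, X z⟩ : TangentBundle I M)) x)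
    (hY : MDifferentiableAt I I.tangent (fun z ↦ (⟨z, Y z⟩ : TangentBundle I M)) x) :
    mvfderiv I G x (VectorField.mlieBracket I X Y x)
      = mvfderiv I (fun z ↦ mvfderiv I G z (Y z)) x (X x)
        - mvfderiv I (fun z ↦ mvfderiv I G z (X z)) x (Y x) := by
  have hsymm := (contDiffAt_comp_extChartAt_symm hG).isSymmSndFDerivAt (by simp)
  rw [mvfderiv_mvfderiv_apply hG hX, mvfderiv_mvfderiv_apply hG hY,
    mvfderiv_mlieBracket_eq_fderiv hG, hsymm.eq (fieldInChart I x X _), VectorField.lieBracket,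
    map_sub]
  abel

end Calculus

section Torsion

variable {E : Type*} [NormedAddCommGroup E] [NormedSpace ℝ E] [FiniteDimensional ℝ E]
  {H : Type*} [TopologicalSpace H] {I : ModelWithCorners ℝ E H}
  {M : Type*} [TopologicalSpace M] [ChartedSpace H M] [IsManifold I ∞ M]
  {E' : Type*} [NormedAddCommGroup E'] [NormedSpace ℝ E'] [FiniteDimensional ℝ E']
  {H' : Type*} [TopologicalSpace H'] {I' : ModelWithCorners ℝ E' H'}
  {M' : Type*} [TopologicalSpace M'] [ChartedSpace H' M'] [IsManifold I' ∞ M']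
  {f : M → M'}

theorem trivializationAt_apply_eq_mvfderiv {y z : M'} (hz : z ∈ (chartAt H' y).source)
    (v : TangentSpace I' z) :
    (trivializationAt E' (fun y : M' ↦ TangentSpace I' y) y (⟨z, v⟩ : TangentBundle I' M')).2
      = mvfderiv I' (extChartAt I' y) z v := by
  have h := DFunLike.congr_fun (TangentBundle.continuousLinearMapAt_trivializationAt
    (I := I') hz) v
  rw [Trivialization.continuousLinearMapAt_apply, Trivialization.linearMapAt_apply, if_pos
    (show z ∈ (trivializationAt E' (TangentSpace I') y).baseSet from hz)] at h
  exact h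

theorem symmL_trivializationAt_apply {y : M'} (v : TangentSpace I' y) :
    (trivializationAt E' (fun y : M' ↦ TangentSpace I' y) y).symmL ℝ y
      (trivializationAt E' (fun y : M' ↦ TangentSpace I' y) y (⟨y, v⟩ : TangentBundle I' M')).2
      = v := by
  rw [Bundle.Trivialization.symmL_apply _ (FiberBundle.mem_baseSet_trivializationAt' y)]
  exact Bundle.Trivialization.symm_apply_apply_mk _ (FiberBundle.mem_baseSet_trivializationAt' y) v

theorem trivializationAt_extend {y z : M'} (hz : z ∈ (chartAt H' y).source)
    (v : TangentSpace I' y) :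
    (trivializationAt E' (fun y : M' ↦ TangentSpace I' y) y
      (⟨z, FiberBundle.extend E' (E := fun y : M' ↦ TangentSpace I' y) v z⟩ :
        TangentBundle I' M')).2
      = (trivializationAt E' (fun y : M' ↦ TangentSpace I' y) y
        (⟨y, v⟩ : TangentBundle I' M')).2 := by
  simp only [FiberBundle.extend]
  rw [Bundle.Trivialization.apply_mk_symm _ hz]

theorem mlieBracket_extend [I'.Boundaryless] {y : M'} (v w : TangentSpace I' y) :
    VectorField.mlieBracket I' (FiberBundle.extend E' (E := fun y : M' ↦ TangentSpace I' y) v)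
      (FiberBundle.extend E' (E := fun y : M' ↦ TangentSpace I' y) w) y = 0 := by
  have hG : ContMDiffAt I' 𝓘(ℝ, E') 2 (extChartAt I' y) y := by
    exact contMDiffAt_extChartAt
  have hconst (v u : TangentSpace I' y) : mvfderiv I' (fun z ↦ mvfderiv I' (extChartAt I' y) z
      (FiberBundle.extend E' (E := fun y : M' ↦ TangentSpace I' y) v z)) y u = 0 := by
    have he : (fun z ↦ mvfderiv I' (extChartAt I' y) z
        (FiberBundle.extend E' (E := fun y : M' ↦ TangentSpace I' y) v z)) =ᶠ[𝓝 y]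
        fun _ ↦ (trivializationAt E' (fun y : M' ↦ TangentSpace I' y) y
          (⟨y, v⟩ : TangentBundle I' M')).2 := by
      filter_upwards [chart_source_mem_nhds H' y] with z hz
      rw [← trivializationAt_apply_eq_mvfderiv hz, trivializationAt_extend hz]
    rw [mvfderiv_congr he, mvfderiv_const]
    rfl
  have h := mvfderiv_mlieBracket hG
    (FiberBundle.mdifferentiableAt_extend (I := I') (F := E') (V := fun y : M' ↦ TangentSpace I' y) v)
    (FiberBundle.mdifferentiableAt_extend (I := I') (F := E') (V := fun y : M' ↦ TangentSpace I' y) w)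
  rw [hconst, hconst, sub_zero, ← trivializationAt_apply_eq_mvfderiv (mem_chart_source H' y)] at h
  rw [← symmL_trivializationAt_apply (VectorField.mlieBracket I' _ _ y), h, map_zero]

theorem cov_extend_sub_cov_extend [I'.Boundaryless]
    {cov : CovariantDerivative I' E' (fun y : M' ↦ TangentSpace I' y)} (hcov : cov.torsion = 0)
    {y : M'} (v w : TangentSpace I' y) :
    cov (FiberBundle.extend E' (E := fun y : M' ↦ TangentSpace I' y) w) y v
      - cov (FiberBundle.extend E' (E := fun y : M' ↦ TangentSpace I' y) v) y w = 0 := by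
  have h := cov.torsion_apply_eq_extend v w
  rw [mlieBracket_extend, hcov, FiberBundle.extend_apply_self, FiberBundle.extend_apply_self] at h
  simpa using h.symm

theorem trivializationAt_pushField_eventuallyEq (hf : ContMDiff I I' ∞ f) (x : M)
    (Y : Π x : M, TangentSpace I x) :
    (fun z ↦ (trivializationAt E' (fun y : M' ↦ TangentSpace I' y) (f x)
        (⟨f z, pushField I I' f Y z⟩ : TangentBundle I' M')).2)
      =ᶠ[𝓝 x] fun z ↦ mvfderiv I (extChartAt I' (f x) ∘ f) z (Y z) := by
  filter_upwards [hf.continuous.continuousAt (chart_source_mem_nhds H' (f x))] with z hz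
  refine (trivializationAt_apply_eq_mvfderiv hz _).trans ?_
  exact (DFunLike.congr_fun (mfderiv_comp z (mdifferentiableAt_extChartAt (I := I') hz)
    (hf.mdifferentiableAt (by simp))) (Y z)).symm

theorem contMDiffAt_extChartAt_comp (hf : ContMDiff I I' ∞ f) (x : M) :
    ContMDiffAt I 𝓘(ℝ, E') 2 (extChartAt I' (f x) ∘ f) x := by
  exact contMDiffAt_extChartAt.comp x ((hf x).of_le (by exact ENat.LEInfty.out))

/-- A torsion free connection stays torsion free along a smooth map. -/
theorem covAlong_pushField_sub [I.Boundaryless] [I'.Boundaryless] (hf : ContMDiff I I' ∞ f)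
    {cov : CovariantDerivative I' E' (fun y : M' ↦ TangentSpace I' y)} (hcov : cov.torsion = 0)
    {X Y : Π x : M, TangentSpace I x} {x : M}
    (hX : MDifferentiableAt I I.tangent (fun z ↦ (⟨z, X z⟩ : TangentBundle I M)) x)
    (hY : MDifferentiableAt I I.tangent (fun z ↦ (⟨z, Y z⟩ : TangentBundle I M)) x) :
    covAlong I f cov (pushField I I' f Y) x (X x) - covAlong I f cov (pushField I I' f X) x (Y x)
      = mfderiv I I' f x (VectorField.mlieBracket I X Y x) := by
  have h1 := mvfderiv_mlieBracket (contMDiffAt_extChartAt_comp hf x) hX hY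
  have h2 := (trivializationAt_pushField_eventuallyEq hf x (VectorField.mlieBracket I X Y)).eq_of_nhds
  have h3 := cov_extend_sub_cov_extend hcov (mfderiv I I' f x (X x)) (mfderiv I I' f x (Y x))
  have h4 := symmL_trivializationAt_apply (pushField I I' f (VectorField.mlieBracket I X Y) x)
  rw [h2, h1, map_sub] at h4
  unfold covAlong
  rw [mvfderiv_congr (trivializationAt_pushField_eventuallyEq hf x X),
    mvfderiv_congr (trivializationAt_pushField_eventuallyEq hf x Y)]
  simp only [add_apply, ContinuousLinearMap.comp_apply]
  refine Eq.trans ?_ h4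
  rw [add_sub_add_comm]
  exact (congrArg _ h3).trans (add_zero _)

variable (I) in
/-- The derivative of a vector-valued map, read in the preferred chart of the source at `x`. -/
def mvfderivInChart (G : M → E') (x z : M) : E →L[ℝ] E' :=
  inTangentCoordinates I 𝓘(ℝ, E') (id : M → M) G (fun z ↦ mfderiv I 𝓘(ℝ, E') G z) x z

theorem mvfderivInChart_apply (G : M → E') {x z : M} (hz : z ∈ (chartAt H x).source)
    (v : TangentSpace I z) :
    mvfderivInChart I G x z (trivializationAt E (fun y : M ↦ TangentSpace I y) x
      (⟨z, v⟩ : TangentBundle I M)).2 = mvfderiv I G z v := by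
  have hz' : z ∈ (extChartAt I x).source := by rwa [extChartAt_source]
  rw [mvfderivInChart, inTangentCoordinates_eq_mfderiv_comp (by exact hz) (Set.mem_univ _),
    trivializationAt_apply_eq_mvfderiv hz]
  have h := DFunLike.congr_fun (mfderivWithin_extChartAt_symm_comp_mfderiv_extChartAt' hz') v
  have hid : mfderiv 𝓘(ℝ, E') 𝓘(ℝ, E') (extChartAt 𝓘(ℝ, E') (G x)) (G z)
      = ContinuousLinearMap.id ℝ E' := by
    rw [extChartAt_model_space_eq_id]
    exact mfderiv_id
  refine Eq.trans ?_ (congrArg (mvfderiv I G z) h)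
  exact DFunLike.congr_fun hid _

theorem mdifferentiableAt_mvfderivInChart {G : M → E'} {x : M}
    (hG : ContMDiffAt I 𝓘(ℝ, E') 2 G x) :
    MDifferentiableAt I 𝓘(ℝ, E →L[ℝ] E') (mvfderivInChart I G x) x :=
  (hG.mfderiv_const (m := 1) (by norm_num)).mdifferentiableAt one_ne_zero

/-- If `df_x` is injective, a vector field `Y` for which `df(Y)` is differentiable at `x` is
differentiable at `x`. -/
theorem mdifferentiableAt_of_pushField (hf : ContMDiff I I' ∞ f) {x : M}
    (hinj : Function.Injective (mfderiv I I' f x)) {Y : Π x : M, TangentSpace I x}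
    (hY : MDiffAlongAt I I' f (pushField I I' f Y) x) :
    MDifferentiableAt I I.tangent (fun z ↦ (⟨z, Y z⟩ : TangentBundle I M)) x := by
  let e := trivializationAt E (fun y : M ↦ TangentSpace I y) x
  let e' := trivializationAt E' (fun y : M' ↦ TangentSpace I' y) (f x)
  let A : M → E →L[ℝ] E' := mvfderivInChart I (extChartAt I' (f x) ∘ f) x
  have hA : MDifferentiableAt I 𝓘(ℝ, E →L[ℝ] E') A x :=
    mdifferentiableAt_mvfderivInChart (contMDiffAt_extChartAt_comp hf x)
  have hAY : ∀ᶠ z in 𝓝 x, A z (e (⟨z, Y z⟩ : TangentBundle I M)).2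
      = (e' (⟨f z, pushField I I' f Y z⟩ : TangentBundle I' M')).2 := by
    filter_upwards [trivializationAt_pushField_eventuallyEq hf x Y, chart_source_mem_nhds H x]
      with z hz hz'
    exact (mvfderivInChart_apply _ hz' _).trans hz.symm
  have hAx : LinearMap.ker (A x : E →ₗ[ℝ] E') = ⊥ := by
    refine LinearMap.ker_eq_bot'.2 fun v hv ↦ ?_
    have hx : x ∈ e.baseSet := FiberBundle.mem_baseSet_trivializationAt' x
    let u : TangentSpace I x := e.symm x v
    have hu : (e (⟨x, u⟩ : TangentBundle I M)).2 = v := by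
      rw [Bundle.Trivialization.apply_mk_symm _ hx]
    have h1 : (e' (⟨f x, mfderiv I I' f x u⟩ : TangentBundle I' M')).2 = 0 := by
      have h := (trivializationAt_pushField_eventuallyEq hf x (fun z ↦ e.symm z v)).eq_of_nhds
      have h' := mvfderivInChart_apply (I := I) (extChartAt I' (f x) ∘ f) (mem_chart_source H x) u
      exact h.trans (h'.symm.trans ((congrArg (A x) hu).trans hv))
    have h2 := symmL_trivializationAt_apply (mfderiv I I' f x u)
    rw [h1, map_zero] at h2
    have h3 : u = 0 := hinj (h2.symm.trans (map_zero _).symm)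
    rw [← hu, h3]
    exact (e.linear ℝ hx).map_zero
  obtain ⟨L, hL⟩ := LinearMap.exists_leftInverse_of_injective (A x : E →ₗ[ℝ] E') hAx
  let L' : E' →L[ℝ] E := L.toContinuousLinearMap
  have hB : MDifferentiableAt I 𝓘(ℝ, E →L[ℝ] E) (fun z ↦ L' ∘L A z) x :=
    mdifferentiableAt_const.clm_comp hA
  have hBx : L' ∘L A x = ContinuousLinearMap.id ℝ E := by
    ext v
    exact LinearMap.congr_fun hL v
  have hBi : MDifferentiableAt I 𝓘(ℝ, E →L[ℝ] E) (fun z ↦ (L' ∘L A z).inverse) x := by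
    have h : DifferentiableAt ℝ (ContinuousLinearMap.inverse : (E →L[ℝ] E) → (E →L[ℝ] E))
        (L' ∘L A x) := by
      rw [hBx]
      exact ((contDiffAt_map_inverse (n := 1) (ContinuousLinearEquiv.refl ℝ E)).differentiableAt
        one_ne_zero)
    exact h.mdifferentiableAt.comp x hB
  have hinv : ∀ᶠ z in 𝓝 x, (L' ∘L A z).IsInvertible := by
    have h : ∀ᶠ B in 𝓝 (L' ∘L A x), B.IsInvertible := by
      rw [hBx]
      exact ContinuousLinearEquiv.nhds (ContinuousLinearEquiv.refl ℝ E)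
    exact hB.continuousAt.eventually h
  have hw := (((mdifferentiableAt_totalSpace I' _).1 hY).2)
  rw [mdifferentiableAt_section]
  refine (hBi.clm_apply ((mdifferentiableAt_const (c := L')).clm_apply hw)).congr_of_eventuallyEq ?_
  filter_upwards [hAY, hinv] with z hz hz'
  rw [← hz]
  exact (hz'.inverse_apply_self _).symm

end Torsion

section Parallel

variable {E : Type*} [NormedAddCommGroup E] [NormedSpace ℝ E] [FiniteDimensional ℝ E]
  {H : Type*} [TopologicalSpace H] {I : ModelWithCorners ℝ E H}
  {M : Type*} [TopologicalSpace M] [ChartedSpace H M] [IsManifold I ∞ M]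
  {E' : Type*} [NormedAddCommGroup E'] [NormedSpace ℝ E'] [FiniteDimensional ℝ E']
  {H' : Type*} [TopologicalSpace H'] {I' : ModelWithCorners ℝ E' H'}
  {M' : Type*} [TopologicalSpace M'] [ChartedSpace H' M'] [IsManifold I' ∞ M']
  {f : M → M'}

theorem isCovariantDerivativeOn_covAlong_id
    (cov : CovariantDerivative I' E' (fun y : M' ↦ TangentSpace I' y)) :
    IsCovariantDerivativeOn E' (V := fun y : M' ↦ TangentSpace I' y) (covAlong I' id cov) where
  add hσ hσ' _ := covAlong_add (f := id) cov hσ hσ'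
  leibniz hσ hg _ := covAlong_smul (f := id) cov hg hσ

theorem covAlong_id_extend (cov : CovariantDerivative I' E' (fun y : M' ↦ TangentSpace I' y))
    {y : M'} (v : TangentSpace I' y) :
    covAlong I' id cov (FiberBundle.extend E' (E := fun y : M' ↦ TangentSpace I' y) v) y
      = cov (FiberBundle.extend E' (E := fun y : M' ↦ TangentSpace I' y) v) y := by
  have he : (fun z ↦ (trivializationAt E' (fun y : M' ↦ TangentSpace I' y) y
      (⟨z, FiberBundle.extend E' (E := fun y : M' ↦ TangentSpace I' y) v z⟩ :
        TangentBundle I' M')).2) =ᶠ[𝓝 y] fun _ ↦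
      (trivializationAt E' (fun y : M' ↦ TangentSpace I' y) y
        (⟨y, v⟩ : TangentBundle I' M')).2 := by
    filter_upwards [chart_source_mem_nhds H' y] with z hz using trivializationAt_extend hz v
  unfold covAlong
  simp only [id_eq, FiberBundle.extend_apply_self]
  rw [mvfderiv_congr he, mvfderiv_const, ContinuousLinearMap.comp_zero, zero_add]
  ext u
  exact congrArg (cov (FiberBundle.extend E' (E := fun y : M' ↦ TangentSpace I' y) v) y)
    (DFunLike.congr_fun mfderiv_id u)

/-- A connection, read in the preferred trivialization at `y`. -/
theorem covAlong_id (cov : CovariantDerivative I' E' (fun y : M' ↦ TangentSpace I' y))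
    {σ : Π y : M', TangentSpace I' y} {y : M'}
    (hσ : MDifferentiableAt I' I'.tangent (fun z ↦ (⟨z, σ z⟩ : TangentBundle I' M')) y) :
    covAlong I' id cov σ y = cov σ y := by
  have h := (isCovariantDerivativeOn_covAlong_id cov).difference_apply
    cov.isCovariantDerivativeOnUniv (Set.mem_univ y) hσ
  have h' := (isCovariantDerivativeOn_covAlong_id cov).difference_apply
    cov.isCovariantDerivativeOnUniv (Set.mem_univ y)
    (FiberBundle.mdifferentiableAt_extend (I := I') (F := E')
      (V := fun y : M' ↦ TangentSpace I' y) (σ y))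
  rw [FiberBundle.extend_apply_self] at h'
  rw [covAlong_id_extend, sub_self] at h'
  exact sub_eq_zero.1 (h.symm.trans h')

/-- The chain rule `∇_u (σ ∘ f) = ∇_{df(u)} σ`. -/
theorem covAlong_comp (cov : CovariantDerivative I' E' (fun y : M' ↦ TangentSpace I' y))
    {σ : Π y : M', TangentSpace I' y} {x : M} (hf : MDifferentiableAt I I' f x)
    (hσ : MDifferentiableAt I' I'.tangent (fun z ↦ (⟨z, σ z⟩ : TangentBundle I' M')) (f x)) :
    covAlong I f cov (fun z ↦ σ (f z)) x = cov σ (f x) ∘L mfderiv I I' f x := by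
  rw [← covAlong_id cov hσ]
  have hk := (mdifferentiableAt_section I' _).1 hσ
  have hc := mfderiv_comp x hk hf
  ext u
  have h1 := congrArg ((trivializationAt E' (fun y : M' ↦ TangentSpace I' y) (f x)).symmL ℝ (f x))
    (DFunLike.congr_fun hc u)
  have h2 := congrArg (cov (FiberBundle.extend E' (E := fun y : M' ↦ TangentSpace I' y)
    (σ (f x))) (f x)) (DFunLike.congr_fun (mfderiv_id (I := I') (x := f x)) (mfderiv I I' f x u))
  exact congrArg₂ (· + ·) h1 h2.symm

theorem MDiffAlongAt.sub {V W : Π x : M, TangentSpace I' (f x)} {x : M}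
    (hV : MDiffAlongAt I I' f V x) (hW : MDiffAlongAt I I' f W x) :
    MDiffAlongAt I I' f (fun z ↦ V z - W z) x := by
  have hV' := (mdifferentiableAt_totalSpace I' _).1 hV
  refine (mdifferentiableAt_totalSpace I' _).2 ⟨hV'.1, ?_⟩
  refine (hV'.2.sub ((mdifferentiableAt_totalSpace I' _).1 hW).2).congr_of_eventuallyEq ?_
  filter_upwards [hV.eventually_mem_baseSet] with z hz
  exact ((trivializationAt E' (fun y : M' ↦ TangentSpace I' y) (f x)).linear ℝ hz).map_sub
    (V z) (W z)

theorem MDiffAlongAt.endomorphism {J : Π y : M', TangentSpace I' y →L[ℝ] TangentSpace I' y}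
    (hJ : IsSmoothEndomorphismField J) {V : Π x : M, TangentSpace I' (f x)} {x : M}
    (hf : MDifferentiableAt I I' f x) (hV : MDiffAlongAt I I' f V x) :
    MDiffAlongAt I I' f (fun z ↦ J (f z) (V z)) x := by
  have h := ((hJ (f x)).mdifferentiableAt (by simp)).comp x hf
  exact MDifferentiableAt.clm_bundle_apply (F₁ := E') (F₂ := E') h hV

/-- The endomorphism field `J` along `f`, read in the preferred trivialization at `f x`. -/
def endomorphismInChart (J : Π y : M', TangentSpace I' y →L[ℝ] TangentSpace I' y) (y z : M') :
    E' →L[ℝ] E' :=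
  ContinuousLinearMap.inCoordinates E' (fun y : M' ↦ TangentSpace I' y) E'
    (fun y : M' ↦ TangentSpace I' y) y z y z (J z)

theorem mdifferentiableAt_endomorphismInChart
    {J : Π y : M', TangentSpace I' y →L[ℝ] TangentSpace I' y}
    (hJ : IsSmoothEndomorphismField J) (y : M') :
    MDifferentiableAt I' 𝓘(ℝ, E' →L[ℝ] E') (endomorphismInChart J y) y :=
  ((contMDiffAt_hom_bundle _).1 (hJ y)).2.mdifferentiableAt (by simp)

theorem endomorphismInChart_apply (J : Π y : M', TangentSpace I' y →L[ℝ] TangentSpace I' y)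
    {y z : M'} (hz : z ∈ (chartAt H' y).source) (v : TangentSpace I' z) :
    endomorphismInChart J y z (trivializationAt E' (fun y : M' ↦ TangentSpace I' y) y
        (⟨z, v⟩ : TangentBundle I' M')).2
      = (trivializationAt E' (fun y : M' ↦ TangentSpace I' y) y
        (⟨z, J z v⟩ : TangentBundle I' M')).2 := by
  have hz' : z ∈ (trivializationAt E' (fun y : M' ↦ TangentSpace I' y) y).baseSet := hz
  rw [endomorphismInChart, ContinuousLinearMap.inCoordinates]
  simp only [ContinuousLinearMap.comp_apply]
  rw [Bundle.Trivialization.symmL_apply _ hz', Bundle.Trivialization.symm_apply_apply_mk _ hz',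
    Bundle.Trivialization.continuousLinearMapAt_apply, Bundle.Trivialization.linearMapAt_apply,
    if_pos hz']

theorem covAlong_endomorphism_of_eq_zero
    {J : Π y : M', TangentSpace I' y →L[ℝ] TangentSpace I' y}
    (hJ : IsSmoothEndomorphismField J)
    (cov : CovariantDerivative I' E' (fun y : M' ↦ TangentSpace I' y))
    {V : Π x : M, TangentSpace I' (f x)} {x : M}
    (hf : MDifferentiableAt I I' f x) (hV : MDiffAlongAt I I' f V x) (h0 : V x = 0) :
    covAlong I f cov (fun z ↦ J (f z) (V z)) x = J (f x) ∘L covAlong I f cov V x := by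
  let e := trivializationAt E' (fun y : M' ↦ TangentSpace I' y) (f x)
  have hw := ((mdifferentiableAt_totalSpace I' _).1 hV).2
  have hA := (mdifferentiableAt_endomorphismInChart hJ (f x)).comp x hf
  have he : (fun z ↦ (e (⟨f z, J (f z) (V z)⟩ : TangentBundle I' M')).2) =ᶠ[𝓝 x]
      fun z ↦ (endomorphismInChart J (f x) ∘ f) z (e (⟨f z, V z⟩ : TangentBundle I' M')).2 := by
    filter_upwards [hf.continuousAt (chart_source_mem_nhds H' (f x))] with z hz
    exact (endomorphismInChart_apply J hz (V z)).symm
  have hext : cov (FiberBundle.extend E' (E := fun y : M' ↦ TangentSpace I' y)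
      (0 : TangentSpace I' (f x))) (f x) = 0 := by
    simpa using cov_extend_smul cov (y := f x) 0 0
  have he0 : (e (⟨f x, V x⟩ : TangentBundle I' M')).2 = 0 := by
    rw [h0]
    exact (e.linear ℝ (FiberBundle.mem_baseSet_trivializationAt' (f x))).map_zero
  ext u
  have h1 := mvfderiv_clm_apply hA hw u
  rw [he0, map_zero, add_zero] at h1
  unfold covAlong
  beta_reduce
  rw [mvfderiv_congr he, h0, map_zero, hext]
  simp only [ContinuousLinearMap.comp_apply, ContinuousLinearMap.zero_comp, add_zero]
  refine (congrArg (e.symmL ℝ (f x)) h1).trans ?_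
  set w : E' := mvfderiv I (fun z ↦ (e (⟨f z, V z⟩ : TangentBundle I' M')).2) x u
  have h2 := endomorphismInChart_apply J (mem_chart_source H' (f x)) (e.symmL ℝ (f x) w)
  have h3 : (e (⟨f x, e.symmL ℝ (f x) w⟩ : TangentBundle I' M')).2 = w := by
    have hx := FiberBundle.mem_baseSet_trivializationAt' (F := E')
      (E := fun y : M' ↦ TangentSpace I' y) (f x)
    rw [Bundle.Trivialization.symmL_apply _ hx, Bundle.Trivialization.apply_mk_symm _ hx]
  rw [h3] at h2
  exact (congrArg (e.symmL ℝ (f x)) h2).trans (symmL_trivializationAt_apply _)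

/-- A parallel endomorphism field stays parallel along a map. -/
theorem covAlong_endomorphism
    {J : Π y : M', TangentSpace I' y →L[ℝ] TangentSpace I' y}
    (hJ : IsSmoothEndomorphismField J)
    {cov : CovariantDerivative I' E' (fun y : M' ↦ TangentSpace I' y)} (hcov : IsJConnection cov J)
    {V : Π x : M, TangentSpace I' (f x)} {x : M}
    (hf : MDifferentiableAt I I' f x) (hV : MDiffAlongAt I I' f V x) :
    covAlong I f cov (fun z ↦ J (f z) (V z)) x = J (f x) ∘L covAlong I f cov V x := by
  let σ := FiberBundle.extend E' (E := fun y : M' ↦ TangentSpace I' y) (V x)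
  have hσ := FiberBundle.mdifferentiableAt_extend (I := I') (F := E')
    (V := fun y : M' ↦ TangentSpace I' y) (V x)
  have hJσ : MDifferentiableAt I' I'.tangent
      (fun z ↦ (⟨z, J z (σ z)⟩ : TangentBundle I' M')) (f x) :=
    MDiffAlongAt.endomorphism (f := id) hJ mdifferentiableAt_id hσ
  have hσf : MDiffAlongAt I I' f (fun z ↦ σ (f z)) x := MDifferentiableAt.comp x hσ hf
  let W : Π x : M, TangentSpace I' (f x) := fun z ↦ V z - σ (f z)
  have hW : MDiffAlongAt I I' f W x := hV.sub hσf
  have hW0 : W x = 0 := by simp [W, σ]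
  have h1 : V = W + fun z ↦ σ (f z) := by
    funext z
    simp [W]
  have h2 : (fun z ↦ J (f z) (V z)) = (fun z ↦ J (f z) (W z)) + fun z ↦ J (f z) (σ (f z)) := by
    funext z
    simp [W]
  rw [h2, covAlong_add cov (hW.endomorphism hJ hf) (hσf.endomorphism hJ hf),
    covAlong_endomorphism_of_eq_zero hJ cov hf hW hW0, covAlong_comp cov hf hJσ]
  conv_rhs => rw [h1, covAlong_add cov hW hσf, covAlong_comp cov hf hσ]
  rw [ContinuousLinearMap.comp_add]
  congr 1
  ext u
  exact sub_eq_zero.1 (hcov (f x) σ hσ (mfderiv I I' f x u))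

end Parallel

section Invariant

variable {E : Type*} [NormedAddCommGroup E] [NormedSpace ℝ E] [FiniteDimensional ℝ E]
  {H : Type*} [TopologicalSpace H] {I : ModelWithCorners ℝ E H}
  {M : Type*} [TopologicalSpace M] [ChartedSpace H M] [IsManifold I ∞ M]
  [RiemannianBundle (fun x : M ↦ TangentSpace I x)]
  {E' : Type*} [NormedAddCommGroup E'] [NormedSpace ℝ E'] [FiniteDimensional ℝ E']
  {H' : Type*} [TopologicalSpace H'] {I' : ModelWithCorners ℝ E' H'}
  {M' : Type*} [TopologicalSpace M'] [ChartedSpace H' M'] [IsManifold I' ∞ M']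
  [RiemannianBundle (fun y : M' ↦ TangentSpace I' y)]
  {f : M → M'} {J : Π y : M', TangentSpace I' y →L[ℝ] TangentSpace I' y}

theorem IsIsometricImmersion.mdifferentiableAt (hf : IsIsometricImmersion I I' f) (x : M) :
    MDifferentiableAt I I' f x :=
  hf.smooth.mdifferentiableAt (by simp)

theorem IsIsometricImmersion.mfderiv_injective (hf : IsIsometricImmersion I I' f) (x : M) :
    Function.Injective (mfderiv I I' f x) := by
  refine (injective_iff_map_eq_zero _).2 fun u hu ↦ ?_
  have h := hf.isometric x u u
  rw [hu, inner_zero_left] at h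
  exact inner_self_eq_zero.1 h.symm

theorem mfderiv_inducedT (hf : IsIsometricImmersion I I' f) (hinv : IsInvariant I f J) (x : M)
    (u : TangentSpace I x) :
    mfderiv I I' f x (inducedT I f J x u) = J (f x) (mfderiv I I' f x u) := by
  have h := tangentialPart_add_normalPart hf x (J (f x) (mfderiv I I' f x u))
  obtain ⟨v, hv⟩ := hinv x _ ⟨u, rfl⟩
  have h0 : normalPart I I' f x (J (f x) (mfderiv I I' f x u)) = 0 := by
    rw [← normalPart_apply_tangent x v]
    exact congrArg _ hv.symm
  rw [h0, add_zero] at h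
  exact h

theorem pushField_inducedT (hf : IsIsometricImmersion I I' f) (hinv : IsInvariant I f J)
    (Y : Π x : M, TangentSpace I x) :
    pushField I I' f (fun z ↦ inducedT I f J z (Y z))
      = fun z ↦ J (f z) (pushField I I' f Y z) :=
  funext fun z ↦ mfderiv_inducedT hf hinv z (Y z)

theorem inner_inducedT (hf : IsIsometricImmersion I I' f) (hinv : IsInvariant I f J)
    (hsymm : ∀ (y : M') (u v : TangentSpace I' y), inner ℝ (J y u) v = inner ℝ u (J y v))
    (x : M) (u v : TangentSpace I x) :
    inner ℝ (inducedT I f J x u) v = inner ℝ u (inducedT I f J x v) := by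
  rw [← hf.isometric, ← hf.isometric, mfderiv_inducedT hf hinv, mfderiv_inducedT hf hinv, hsymm]

theorem normalPart_endomorphism (hf : IsIsometricImmersion I I' f) (hinv : IsInvariant I f J)
    (hsymm : ∀ (y : M') (u v : TangentSpace I' y), inner ℝ (J y u) v = inner ℝ u (J y v))
    (x : M) (w : TangentSpace I' (f x)) :
    normalPart I I' f x (J (f x) w) = J (f x) (normalPart I I' f x w) := by
  have hn : J (f x) (normalPart I I' f x w) ∈ normalSpace I I' f x := by
    rw [normalSpace, Submodule.mem_orthogonal]
    intro t ht
    rw [← hsymm]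
    exact (Submodule.mem_orthogonal _ _).1 (Submodule.starProjection_apply_mem _ w) _ (hinv x t ht)
  conv_lhs => rw [← tangentialPart_add_normalPart hf x w, map_add, map_add,
    ← mfderiv_inducedT hf hinv, normalPart_apply_tangent, zero_add]
  exact Submodule.starProjection_eq_self_iff.2 hn

theorem mdifferentiableAt_inducedT (hf : IsIsometricImmersion I I' f) (hinv : IsInvariant I f J)
    (hJ : IsSmoothEndomorphismField J) {Y : Π x : M, TangentSpace I x} {x : M}
    (hY : MDifferentiableAt I I.tangent (fun z ↦ (⟨z, Y z⟩ : TangentBundle I M)) x) :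
    MDifferentiableAt I I.tangent
      (fun z ↦ (⟨z, inducedT I f J z (Y z)⟩ : TangentBundle I M)) x := by
  refine mdifferentiableAt_of_pushField hf.smooth (hf.mfderiv_injective x) ?_
  rw [pushField_inducedT hf hinv]
  exact (mdiffAlongAt_pushField hf.smooth hY).endomorphism hJ (hf.mdifferentiableAt x)

theorem covAlong_pushField_inducedT (hf : IsIsometricImmersion I I' f) (hinv : IsInvariant I f J)
    (hJ : IsSmoothEndomorphismField J)
    {cov : CovariantDerivative I' E' (fun y : M' ↦ TangentSpace I' y)} (hcov : IsJConnection cov J)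
    {Y : Π x : M, TangentSpace I x} {x : M}
    (hY : MDifferentiableAt I I.tangent (fun z ↦ (⟨z, Y z⟩ : TangentBundle I M)) x)
    (u : TangentSpace I x) :
    covAlong I f cov (pushField I I' f (fun z ↦ inducedT I f J z (Y z))) x u
      = J (f x) (covAlong I f cov (pushField I I' f Y) x u) := by
  rw [pushField_inducedT hf hinv, covAlong_endomorphism hJ hcov (hf.mdifferentiableAt x)
    (mdiffAlongAt_pushField hf.smooth hY)]
  rfl

/-- On an invariant submanifold, `h(X, TY) = J h(X, Y)`. -/
theorem secondFundamentalForm_inducedT (hf : IsIsometricImmersion I I' f)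
    (hinv : IsInvariant I f J) (hJ : IsSmoothEndomorphismField J)
    (hsymm : ∀ (y : M') (u v : TangentSpace I' y), inner ℝ (J y u) v = inner ℝ u (J y v))
    {cov : CovariantDerivative I' E' (fun y : M' ↦ TangentSpace I' y)} (hcov : IsJConnection cov J)
    (x : M) (u v : TangentSpace I x) :
    secondFundamentalForm hf.smooth cov x u (inducedT I f J x v)
      = J (f x) (secondFundamentalForm hf.smooth cov x u v) := by
  let Y := FiberBundle.extend E (E := fun y : M ↦ TangentSpace I y) v
  have hY := FiberBundle.mdifferentiableAt_extend (I := I) (F := E)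
    (V := fun y : M ↦ TangentSpace I y) v
  have hv : Y x = v := FiberBundle.extend_apply_self E v
  have h1 := secondFundamentalForm_apply hf.smooth cov hY u
  have h2 := secondFundamentalForm_apply hf.smooth cov (mdifferentiableAt_inducedT hf hinv hJ hY) u
  rw [covAlong_pushField_inducedT hf hinv hJ hcov hY, normalPart_endomorphism hf hinv hsymm,
    ← h1] at h2
  rwa [FiberBundle.extend_apply_self] at h2

/-- The second fundamental form of a torsion free connection is symmetric. -/
theorem secondFundamentalForm_symm [I.Boundaryless] [I'.Boundaryless] (hf : ContMDiff I I' ∞ f)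
    {cov : CovariantDerivative I' E' (fun y : M' ↦ TangentSpace I' y)} (hcov : cov.torsion = 0)
    (x : M) (u v : TangentSpace I x) :
    secondFundamentalForm hf cov x u v = secondFundamentalForm hf cov x v u := by
  have hX := FiberBundle.mdifferentiableAt_extend (I := I) (F := E)
    (V := fun y : M ↦ TangentSpace I y) u
  have hY := FiberBundle.mdifferentiableAt_extend (I := I) (F := E)
    (V := fun y : M ↦ TangentSpace I y) v
  have h1 := secondFundamentalForm_apply hf cov hY u
  have h2 := secondFundamentalForm_apply hf cov hX v
  have h3 := congrArg (normalPart I I' f x) (covAlong_pushField_sub hf hcov hX hY)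
  rw [normalPart_apply_tangent, map_sub] at h3
  rw [FiberBundle.extend_apply_self] at h1 h2
  rw [FiberBundle.extend_apply_self, FiberBundle.extend_apply_self, ← h1, ← h2] at h3
  exact sub_eq_zero.1 h3

theorem inducedT_comp_shapeOperator [I.Boundaryless] [I'.Boundaryless]
    (hf : IsIsometricImmersion I I' f)
    (hinv : IsInvariant I f J) (hJ : IsSmoothEndomorphismField J)
    (hsymm : ∀ (y : M') (u v : TangentSpace I' y), inner ℝ (J y u) v = inner ℝ u (J y v))
    {cov : CovariantDerivative I' E' (fun y : M' ↦ TangentSpace I' y)} (hcov : IsJConnection cov J)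
    (htor : cov.torsion = 0) (x : M) (ξ : TangentSpace I' (f x)) :
    inducedT I f J x ∘L shapeOperator hf.smooth cov x ξ
      = shapeOperator hf.smooth cov x ξ ∘L inducedT I f J x := by
  ext u
  refine ext_inner_right ℝ fun v ↦ ?_
  simp only [ContinuousLinearMap.comp_apply]
  rw [inner_inducedT hf hinv hsymm, inner_shapeOperator, inner_shapeOperator,
    secondFundamentalForm_symm hf.smooth htor x (inducedT I f J x u),
    secondFundamentalForm_inducedT hf hinv hJ hsymm hcov,
    secondFundamentalForm_inducedT hf hinv hJ hsymm hcov,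
    secondFundamentalForm_symm hf.smooth htor x v]

theorem nijenhuis_inducedT [I.Boundaryless] [I'.Boundaryless]
    (hf : IsIsometricImmersion I I' f)
    (hinv : IsInvariant I f J) (hJ : IsSmoothEndomorphismField J)
    {cov : CovariantDerivative I' E' (fun y : M' ↦ TangentSpace I' y)} (hcov : IsJConnection cov J)
    (htor : cov.torsion = 0) {X Y : Π x : M, TangentSpace I x} {x : M}
    (hX : MDifferentiableAt I I.tangent (fun z ↦ (⟨z, X z⟩ : TangentBundle I M)) x)
    (hY : MDifferentiableAt I I.tangent (fun z ↦ (⟨z, Y z⟩ : TangentBundle I M)) x) :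
    nijenhuis (inducedT I f J) X Y x = 0 := by
  have hTX := mdifferentiableAt_inducedT hf hinv hJ hX
  have hTY := mdifferentiableAt_inducedT hf hinv hJ hY
  refine hf.mfderiv_injective x ?_
  rw [map_zero, nijenhuis, map_add, map_sub, map_sub]
  simp only [mfderiv_inducedT hf hinv]
  rw [← covAlong_pushField_sub hf.smooth htor hTX hTY, ← covAlong_pushField_sub hf.smooth htor hTX hY,
    ← covAlong_pushField_sub hf.smooth htor hX hTY, ← covAlong_pushField_sub hf.smooth htor hX hY]
  simp only [covAlong_pushField_inducedT hf hinv hJ hcov hX,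
    covAlong_pushField_inducedT hf hinv hJ hcov hY, map_sub]
  abel

end Invariant

end MetallicGeometry

end

theorem mainTheorem7 (n r p q : ℕ)
    {M : Type*} [TopologicalSpace M] [ChartedSpace (EuclideanSpace ℝ (Fin n)) M]
    [IsManifold (𝓡 n) ∞ M]
    [RiemannianBundle (fun x : M ↦ TangentSpace (𝓡 n) x)]
    [IsContMDiffRiemannianBundle (𝓡 n) ∞ (EuclideanSpace ℝ (Fin n))
      (fun x : M ↦ TangentSpace (𝓡 n) x)]
    {M' : Type*} [TopologicalSpace M'] [ChartedSpace (EuclideanSpace ℝ (Fin (n + r))) M']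
    [IsManifold (𝓡 (n + r)) ∞ M']
    [RiemannianBundle (fun y : M' ↦ TangentSpace (𝓡 (n + r)) y)]
    [IsContMDiffRiemannianBundle (𝓡 (n + r)) ∞ (EuclideanSpace ℝ (Fin (n + r)))
      (fun y : M' ↦ TangentSpace (𝓡 (n + r)) y)]
    (J : Π y : M', TangentSpace (𝓡 (n + r)) y →L[ℝ] TangentSpace (𝓡 (n + r)) y)
    (cov : CovariantDerivative (𝓡 (n + r)) (EuclideanSpace ℝ (Fin (n + r)))
      (fun y : M' ↦ TangentSpace (𝓡 (n + r)) y))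
    (hJ : IsLocallyMetallicRiemannian p q J cov)
    (f : M → M') (hf : IsIsometricImmersion (𝓡 n) (𝓡 (n + r)) f)
    (hinv : IsInvariant (𝓡 n) f J) :
    (∀ (U : Set M) (N : Fin r → Π x : M, TangentSpace (𝓡 (n + r)) (f x)),
      IsOrthonormalNormalFrameOn (𝓡 n) (𝓡 (n + r)) f N U →
      ∀ (α : Fin r), ∀ x ∈ U,
        inducedT (𝓡 n) f J x ∘L shapeOperator hf.smooth cov x (N α x)
          = shapeOperator hf.smooth cov x (N α x) ∘L inducedT (𝓡 n) f J x) ∧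
    (∀ X Y : Π x : M, TangentSpace (𝓡 n) x,
      IsSmoothVectorField X → IsSmoothVectorField Y →
      ∀ x : M, nijenhuis (inducedT (𝓡 n) f J) X Y x = 0) := by
  obtain ⟨⟨-, -, hJs, -, hsymm⟩, ⟨-, htor⟩, hpar⟩ := hJ
  refine ⟨fun U N _ α x _ ↦ inducedT_comp_shapeOperator hf hinv hJs hsymm hpar htor x (N α x),
    fun X Y hX hY x ↦ nijenhuis_inducedT hf hinv hJs hpar htor
      (ContMDiff.mdifferentiable hX (by simp) x) (ContMDiff.mdifferentiable hY (by simp) x)⟩
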